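/- Here $\mathbb{N}=\{1,2,\dots\}$ and all graphs are finite and simple. For $h,d\in\mathbb{N}$ let $U_{h,d}$ be the closure of the complete $d$-ary tree of vertex-height $h$: the tree is the rooted tree in which every root-to-leaf path has exactly $h$ vertices and every non-leaf vertex has exactly $d$ children, and in its closure two distinct vertices are adjacent if and only if one of them lies on the path from the root to the other. An $H$-model in a graph $G$ is a collection $(T_x : x\in V(H))$ of pairwise vertex-disjoint subtrees of $G$ such that for each $xy\in E(H)$ some edge of $G$ joins $T_x$ and $T_y$. It is non-trivial if $|V(T_x)|\ge 2$ for each $x\in V(H)$. It is odd if there is a $2$-colouring of $\bigcup_{x} V(T_x)$ such that each $T_x$ is properly coloured and, for each $xy\in E(H)$, there is a monochromatic edge of $G$ joining $T_x$ and $T_y$. A (not necessarily proper) colouring of $G$ has clustering $m$ if every connected component of the subgraph induced by each colour class has at most $m$ vertices. **Lemma.** For all $d,h,w\in\mathbb{N}$, every graph $G$ with treewidth at most $w$ that does not contain a non-trivial odd $U_{h,d}$-model can be coloured with $3\cdot 2^{h-1}-2$ colours with clustering $dw+d-w$. -/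

import Mathlib

namespace OddMinor

/-! ### Tree-decompositions and treewidth -/

/-- A tree-decomposition of `G`: bags indexed by the nodes of a (finite) tree. -/
structure TreeDecomposition {V : Type*} (G : SimpleGraph V) where
  /-- the nodes of the indexing tree -/
  Node : Type
  [fintypeNode : Fintype Node]
  /-- the indexing tree -/
  tree : SimpleGraph Node
  isTree : tree.IsTree
  /-- the bags -/
  bag : Node → Finset V
  /-- the two ends of every edge lie in a common bag -/
  edge_mem : ∀ v w : V, G.Adj v w → ∃ x, v ∈ bag x ∧ w ∈ bag x
  /-- the nodes whose bag contains `v` induce a non-empty subtree -/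
  connected : ∀ v : V, (tree.induce {x | v ∈ bag x}).Connected

attribute [instance] TreeDecomposition.fintypeNode

/-- The width: maximum bag size minus one. It is an integer because the width is `-1` if all
bags are empty. -/
def TreeDecomposition.width {V : Type*} {G : SimpleGraph V} (D : TreeDecomposition G) : ℤ :=
  ((Finset.univ.sup fun x => (D.bag x).card : ℕ) : ℤ) - 1

/-- The treewidth of a finite graph: the minimum width of a tree-decomposition. -/
noncomputable def treewidth {V : Type*} (G : SimpleGraph V) : ℤ :=
  sInf (Set.range fun D : TreeDecomposition G => D.width)

/-- The decomposition with a single bag. -/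
def TreeDecomposition.trivial {V : Type*} [Fintype V] (G : SimpleGraph V) :
    TreeDecomposition G where
  Node := Unit
  tree := ⊥
  isTree := SimpleGraph.IsTree.of_subsingleton
  bag := fun _ => Finset.univ
  edge_mem := fun v w _ => ⟨(), Finset.mem_univ v, Finset.mem_univ w⟩
  connected := fun v => by
    have : Nonempty {x : Unit | v ∈ (Finset.univ : Finset V)} := ⟨⟨(), Finset.mem_univ v⟩⟩
    exact SimpleGraph.Connected.mk SimpleGraph.Preconnected.of_subsingleton

/-- The infimum in the definition of the treewidth is a minimum. -/
theorem exists_width_eq_treewidth {V : Type*} [Fintype V] (G : SimpleGraph V) :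
    ∃ D : TreeDecomposition G, D.width = treewidth G := by
  have h : sInf (Set.range fun D : TreeDecomposition G => D.width) ∈
      Set.range fun D : TreeDecomposition G => D.width := by
    refine Int.csInf_mem ⟨_, ⟨TreeDecomposition.trivial G, rfl⟩⟩ ⟨-1, ?_⟩
    rintro _ ⟨D, rfl⟩
    simp only [TreeDecomposition.width]
    omega
  exact h

/-! ### Models -/

/-- An `H`-model in `G`: pairwise vertex-disjoint subtrees `T x` of `G`, one for each vertex `x`
of `H`, such that for every edge `xy` of `H` some edge of `G` joins `T x` and `T y`. -/
structure Model {W V : Type*} (H : SimpleGraph W) (G : SimpleGraph V) where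
  /-- the branch trees -/
  T : W → G.Subgraph
  isTree : ∀ x, (T x).coe.IsTree
  disjoint : ∀ x y, x ≠ y → Disjoint (T x).verts (T y).verts
  exists_adj : ∀ x y, H.Adj x y → ∃ u ∈ (T x).verts, ∃ v ∈ (T y).verts, G.Adj u v

namespace Model

variable {W V : Type*} {H : SimpleGraph W} {G : SimpleGraph V}

/-- The subgraph of `G` that is the union of all `T x` together with all the edges of `G` that
join `T x` and `T y` for an edge `xy` of `H`. -/
def spanned (M : Model H G) : G.Subgraph where
  verts := {v | ∃ x, v ∈ (M.T x).verts}
  Adj u v := (∃ x, (M.T x).Adj u v) ∨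
    ∃ x y, H.Adj x y ∧ u ∈ (M.T x).verts ∧ v ∈ (M.T y).verts ∧ G.Adj u v
  adj_sub := by
    rintro u v (⟨x, h⟩ | ⟨x, y, _, _, _, h⟩)
    · exact (M.T x).adj_sub h
    · exact h
  edge_vert := by
    rintro u v (⟨x, h⟩ | ⟨x, y, _, h, _, _⟩)
    · exact ⟨x, (M.T x).edge_vert h⟩
    · exact ⟨x, h⟩
  symm := ⟨by
    rintro u v (⟨x, h⟩ | ⟨x, y, h, hu, hv, huv⟩)
    · exact Or.inl ⟨x, h.symm⟩
    · exact Or.inr ⟨y, x, h.symm, hv, hu, huv.symm⟩⟩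

/-- The model is odd: some 2-colouring of the spanned subgraph is proper on every branch tree and
has, for every edge `xy` of `H`, a monochromatic edge joining `T x` and `T y`. -/
def IsOdd (M : Model H G) : Prop :=
  ∃ c : M.spanned.verts → Bool,
    (∀ x, ∀ u v : M.spanned.verts, (M.T x).Adj u v → c u ≠ c v) ∧
    ∀ x y, H.Adj x y → ∃ u v : M.spanned.verts,
      (u : V) ∈ (M.T x).verts ∧ (v : V) ∈ (M.T y).verts ∧ M.spanned.Adj u v ∧ c u = c v

/-- The model is non-trivial: every branch tree has at least two vertices. -/
def IsNontrivial (M : Model H G) : Prop :=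
  ∀ x, (M.T x).verts.Nontrivial

end Model

/-! ### Closures of rooted trees -/

/-- In the tree `T` with root `r`, the vertex `u` is a descendant of `v`: `v` lies on the path
from `r` to `u`. -/
def IsDescendant {W : Type*} (T : SimpleGraph W) (r u v : W) : Prop :=
  ∃ p : T.Walk r u, p.IsPath ∧ v ∈ p.support

/-- The closure of the tree `T` with root `r`. -/
def closure {W : Type*} (T : SimpleGraph W) (r : W) : SimpleGraph W where
  Adj u v := u ≠ v ∧ (IsDescendant T r u v ∨ IsDescendant T r v u)
  symm := ⟨fun _ _ h => ⟨h.1.symm, h.2.symm⟩⟩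
  loopless := ⟨fun _ h => h.1 rfl⟩

/-- The vertices of the complete `d`-ary tree of vertex-height `h ≥ 1`: words of length at most
`h - 1` over an alphabet with `d` letters. -/
abbrev Word (h d : ℕ) : Type := {l : List (Fin d) // l.length ≤ h - 1}

/-- The complete `d`-ary tree of vertex-height `h ≥ 1`: the children of the word `l` are the words
`a :: l`, as long as their length is at most `h - 1`. -/
def completeTree (h d : ℕ) : SimpleGraph (Word h d) where
  Adj u v := (∃ a, v.1 = a :: u.1) ∨ ∃ a, u.1 = a :: v.1
  symm := ⟨fun _ _ h => h.symm⟩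
  loopless := ⟨fun u h => by
    rcases h with ⟨a, h⟩ | ⟨a, h⟩ <;> simpa using congrArg List.length h⟩

/-- The root of the complete `d`-ary tree: the empty word. -/
def root (h d : ℕ) : Word h d := ⟨[], Nat.zero_le _⟩

/-- `U h d` is the closure of the complete `d`-ary tree of vertex-height `h ≥ 1`. -/
def U (h d : ℕ) : SimpleGraph (Word h d) :=
  closure (completeTree h d) (root h d)

theorem mem_support_of_suffix {h d : ℕ} {w r : Word h d} (p : (completeTree h d).Walk w r)
    (hr : r = root h d) (u : Word h d) (hu : u.1 <:+ w.1) : u ∈ p.support := by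
  induction p with
  | nil =>
    subst hr
    have : u = root h d := Subtype.ext (List.suffix_nil.1 hu)
    simp [this]
  | @cons w w' r hw p ih =>
    by_cases he : u = w
    · simp [he]
    · rw [SimpleGraph.Walk.support_cons]
      refine List.mem_cons_of_mem _ (ih hr ?_)
      rcases hw with ⟨a, ha⟩ | ⟨a, ha⟩
      · rw [ha]
        exact hu.trans (List.suffix_cons _ _)
      · rw [ha] at hu
        rcases List.suffix_cons_iff.1 hu with h1 | h1
        · exact absurd (Subtype.ext (h1.trans ha.symm)) he
        · exact h1

theorem suffix_of_mem_support {h d : ℕ} {w r : Word h d} (p : (completeTree h d).Walk w r)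
    (hr : r = root h d) (hp : p.IsPath) (u : Word h d) (hu : u ∈ p.support) : u.1 <:+ w.1 := by
  induction p with
  | nil => simp at hu; simp [hu]
  | @cons w w' r hw p ih =>
    rw [SimpleGraph.Walk.cons_isPath_iff] at hp
    rw [SimpleGraph.Walk.support_cons, List.mem_cons] at hu
    rcases hu with rfl | hu
    · exact List.suffix_refl _
    · rcases hw with ⟨a, ha⟩ | ⟨a, ha⟩
      · exact absurd (mem_support_of_suffix p hr w (ha ▸ List.suffix_cons _ _)) hp.2
      · rw [ha]
        exact (ih hr hp.1 hu).trans (List.suffix_cons _ _)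

theorem reachable_root {h d : ℕ} (l : List (Fin d)) (hl : l.length ≤ h - 1) :
    (completeTree h d).Reachable ⟨l, hl⟩ (root h d) := by
  induction l with
  | nil => exact SimpleGraph.Reachable.refl _
  | cons a l ih =>
    have h1 : l.length ≤ h - 1 := by simp at hl; omega
    have h2 : (completeTree h d).Adj ⟨a :: l, hl⟩ ⟨l, h1⟩ := Or.inr ⟨a, rfl⟩
    exact h2.reachable.trans (ih h1)

/-- In the complete `d`-ary tree, the descendants of `v` are the words that extend `v`. -/
theorem isDescendant_completeTree_iff {h d : ℕ} (u v : Word h d) :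
    IsDescendant (completeTree h d) (root h d) u v ↔ v.1 <:+ u.1 := by
  classical
  constructor
  · rintro ⟨p, hp, hv⟩
    exact suffix_of_mem_support p.reverse rfl hp.reverse v (by simpa using hv)
  · intro hv
    obtain ⟨p, hp⟩ := (reachable_root u.1 u.2).exists_isPath
    exact ⟨p.reverse, hp.reverse, by simpa using mem_support_of_suffix p rfl v hv⟩

/-- Adjacency in `U h d`, written out. -/
theorem U_adj {h d : ℕ} (u v : Word h d) :
    (U h d).Adj u v ↔ u ≠ v ∧ (v.1 <:+ u.1 ∨ u.1 <:+ v.1) := by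
  simp [U, closure, isDescendant_completeTree_iff]

/-! ### Clustered colourings -/

/-- The colouring `c` of the finite graph `G` has clustering `m`: every monochromatic component,
that is, every component of the subgraph induced by a colour class, has at most `m` vertices. -/
def HasClustering {V α : Type*} (G : SimpleGraph V) (c : V → α) (m : ℕ) : Prop :=
  ∀ (i : α) (C : (G.induce {v | c v = i}).ConnectedComponent), C.supp.ncard ≤ m

end OddMinor

/-!
Induction on the height: `U (h + 1) d` is a subgraph of the cone over `d` disjoint copies of
`U h d`. In a connected graph, suppose that one distance layer, minus one of its vertices `v₁`,
contains `d` disjoint non-trivial odd `U h d`-models. The lower layers together with `v₁`,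
2-coloured by the parity of the distance, form a branch set for the apex. Every vertex of the layer
other than `v₁` has a neighbour of one fixed colour in it, and every branch tree of the `d` models
has a vertex of that colour because it is non-trivial and properly coloured. So the whole is a
non-trivial odd model of the cone, a contradiction.

Hence the models in a layer minus `v₁` cannot be packed `d` times. As `U h d` is connected, they
span connected subgraphs, which have the Erdős–Pósa property in a graph of treewidth at most `w`:
`(d - 1) * (w + 1)` vertices meet them all. Deleting these and `v₁`, at most
`(d - 1) * (w + 1) + 1 = d * w + d - w` vertices, leaves a model-free layer, coloured by
induction. One new colour for the deleted vertices and two palettes alternating between the layers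
turn `N` colours into `2 * (N + 1)`, and `3 * 2 ^ (h - 1) - 2` solves this recursion.
-/

namespace OddMinor

open SimpleGraph
open scoped Function Finset

section Connectivity

variable {V W : Type*} {G : SimpleGraph V}

theorem subset_of_induce_preconnected {A Z : Set V} (hA : (G.induce A).Preconnected) {a : V}
    (ha : a ∈ A) (haZ : a ∈ Z) (hZ : ∀ u ∈ A, u ∈ Z → ∀ v ∈ A, G.Adj u v → v ∈ Z) : A ⊆ Z := by
  suffices ∀ b : A, (b : V) ∈ Z from fun b hb ↦ this ⟨b, hb⟩
  intro b
  induction (reachable_iff_reflTransGen _ _).1 (hA ⟨a, ha⟩ b) with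
  | refl => exact haZ
  | @tail u v _ huv ih => exact hZ u u.2 ih v v.2 huv

theorem reachable_induce_mono {A B : Set V} (hA : (G.induce A).Preconnected) (hAB : A ⊆ B)
    {u v : V} (hu : u ∈ A) (hv : v ∈ A) : (G.induce B).Reachable ⟨u, hAB hu⟩ ⟨v, hAB hv⟩ :=
  (hA ⟨u, hu⟩ ⟨v, hv⟩).map (induceHomOfLE G hAB).toHom

theorem induce_iUnion_connected {H : SimpleGraph W} (hH : H.Connected) {B : W → Set V}
    (hB : ∀ x, (G.induce (B x)).Connected)
    (hadj : ∀ x y, H.Adj x y → (G.induce (B x ∪ B y)).Connected) :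
    (G.induce (⋃ x, B x)).Connected := by
  have hsub : ∀ x, B x ⊆ ⋃ x, B x := Set.subset_iUnion B
  obtain ⟨x₀⟩ := hH.nonempty
  obtain ⟨⟨r, hr⟩⟩ := (hB x₀).nonempty
  have key : ∀ x, ∀ v (hv : v ∈ B x),
      (G.induce (⋃ x, B x)).Reachable ⟨r, hsub x₀ hr⟩ ⟨v, hsub x hv⟩ := by
    intro x
    induction (reachable_iff_reflTransGen _ _).1 (hH.preconnected x₀ x) with
    | refl => exact fun v hv ↦ reachable_induce_mono (hB x₀).preconnected (hsub x₀) hr hv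
    | @tail x y _ hxy ih =>
      intro v hv
      obtain ⟨⟨u, hu⟩⟩ := (hB x).nonempty
      exact (ih u hu).trans (reachable_induce_mono (hadj x y hxy).preconnected
        (Set.union_subset (hsub x) (hsub y)) (.inl hu) (.inr hv))
  refine (connected_iff_exists_forall_reachable _).2 ⟨⟨r, hsub x₀ hr⟩, fun ⟨v, hv⟩ ↦ ?_⟩
  obtain ⟨x, hx⟩ := Set.mem_iUnion.1 hv
  exact key x v hx

theorem induce_connected_of_descent {A : Set V} {r : V} (hr : r ∈ A) (δ : V → ℕ)
    (h : ∀ v ∈ A, v ≠ r → ∃ u ∈ A, G.Adj u v ∧ δ u < δ v) : (G.induce A).Connected := by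
  refine (connected_iff_exists_forall_reachable _).2 ⟨⟨r, hr⟩, fun v ↦ ?_⟩
  induction hn : δ v using Nat.strong_induction_on generalizing v with
  | _ n ih =>
    obtain rfl | hne := eq_or_ne v ⟨r, hr⟩
    · exact .refl _
    · obtain ⟨u, hu, huv, hlt⟩ := h v v.2 fun h ↦ hne (Subtype.ext h)
      have hadj : (G.induce A).Adj ⟨u, hu⟩ v := huv
      exact (ih _ (hn ▸ hlt) ⟨u, hu⟩ rfl).trans hadj.reachable

theorem induce_image_supp_connected {S : Set V} (C : (G.induce S).ConnectedComponent) :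
    (G.induce (Subtype.val '' C.supp)).Connected := by
  let f : C.toSimpleGraph →g G.induce (Subtype.val '' C.supp) :=
    ⟨fun v ↦ ⟨v.1.1, v.1, v.2, rfl⟩, fun h ↦ h⟩
  refine C.connected_toSimpleGraph.map f ?_
  rintro ⟨_, v, hv, rfl⟩
  exact ⟨⟨v, hv⟩, rfl⟩

theorem exists_adj_of_induce_preconnected {A : Set V} (hA : (G.induce A).Preconnected)
    (hnt : A.Nontrivial) {v : V} (hv : v ∈ A) : ∃ u ∈ A, G.Adj v u := by
  have := hnt.coe_sort
  obtain ⟨u, hu⟩ := hA.exists_adj_of_nontrivial ⟨v, hv⟩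
  exact ⟨u, u.2, hu⟩

theorem exists_forall_eqOn {ι α : Type*} [Nonempty α] {A : ι → Set V}
    (hA : Pairwise (Disjoint on A)) (f : ι → V → α) : ∃ g : V → α, ∀ i, Set.EqOn g (f i) (A i) := by
  classical
  refine ⟨fun v ↦ if h : ∃ i, v ∈ A i then f h.choose v else Classical.arbitrary α,
    fun i v hv ↦ ?_⟩
  have h : ∃ j, v ∈ A j := ⟨i, hv⟩
  have hi : h.choose = i := hA.eq (Set.not_disjoint_iff.2 ⟨v, h.choose_spec, hv⟩)
  simp only [dif_pos h, hi]

end Connectivity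

section Tree

variable {N : Type*} {T : SimpleGraph N} {r t y z : N}

theorem isDescendant_iff_forall_mem_support (hT : T.IsTree) :
    IsDescendant T r y t ↔ ∀ p : T.Walk r y, t ∈ p.support := by
  classical
  constructor
  · rintro ⟨q, hq, ht⟩ p
    have hqp : (⟨q, hq⟩ : T.Path r y) = p.toPath := (hT.isAcyclic.subsingleton_path r y).elim _ _
    exact p.support_toPath_subset_support (hqp ▸ ht)
  · intro h
    obtain ⟨p, hp⟩ := (hT.connected.preconnected r y).exists_isPath
    exact ⟨p, hp, h p⟩

theorem isDescendant_self (hT : T.IsTree) : IsDescendant T r t t :=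
  (isDescendant_iff_forall_mem_support hT).2 fun p ↦ p.end_mem_support

theorem IsDescendant.of_adj (hT : T.IsTree) (hy : IsDescendant T r y t) (hyt : y ≠ t)
    (hyz : T.Adj y z) : IsDescendant T r z t := by
  rw [isDescendant_iff_forall_mem_support hT] at hy ⊢
  intro p
  have ht := hy (p.concat hyz.symm)
  rw [Walk.support_concat, List.mem_append, List.mem_singleton] at ht
  exact ht.resolve_right hyt.symm

theorem IsDescendant.dist_lt (hT : T.IsTree) (hy : IsDescendant T r y t) (hyt : y ≠ t) :
    T.dist r t < T.dist r y := by
  classical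
  obtain ⟨p, hp⟩ := hT.connected.exists_walk_length_eq_dist r y
  have ht := (isDescendant_iff_forall_mem_support hT).1 hy p
  exact (SimpleGraph.dist_le _).trans_lt (hp ▸ p.length_takeUntil_lt_length ht hyt.symm)

theorem isDescendant_of_adj_of_dist_le (hT : T.IsTree) (hty : T.Adj t y)
    (hd : T.dist r t ≤ T.dist r y) : IsDescendant T r y t := by
  classical
  obtain ⟨p, hp, hlen⟩ := hT.connected.exists_path_of_dist r t
  have hyp : y ∉ p.support := fun hy ↦ hd.not_gt <|
    (SimpleGraph.dist_le _).trans_lt (hlen ▸ p.length_takeUntil_lt_length hy hty.symm.ne)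
  exact ⟨p.concat hty, hp.concat hyp hty, by simp [Walk.support_concat]⟩

theorem isDescendant_of_induce_preconnected (hT : T.IsTree) {A : Set N}
    (hA : (T.induce A).Preconnected) (htop : t ∈ A → ∀ x ∈ A, T.dist r t ≤ T.dist r x)
    (hyA : y ∈ A) (hy : IsDescendant T r y t) : ∀ x ∈ A, IsDescendant T r x t :=
  subset_of_induce_preconnected (Z := {x | IsDescendant T r x t}) hA hyA hy
    fun u hu hut v hv huv ↦ by
      obtain rfl | hne := eq_or_ne u t
      · exact isDescendant_of_adj_of_dist_le hT huv (htop hu v hv)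
      · exact hut.of_adj hT hne huv

theorem exists_forall_not_disjoint_imp_mem [Finite N] (hT : T.IsTree) {ι : Type*} [Nonempty ι]
    {A : ι → Set N} (hA : ∀ i, (T.induce (A i)).Connected) :
    ∃ i t, ∀ j, ¬Disjoint (A i) (A j) → t ∈ A j := by
  obtain ⟨r⟩ := hT.connected.nonempty
  have hne : ∀ i, (A i).Nonempty := fun i ↦ Set.nonempty_coe_sort.1 (hA i).nonempty
  choose top htop hmin using fun i ↦ (A i).exists_min_image (T.dist r) (A i).toFinite (hne i)
  have hdesc : ∀ i, ∀ x ∈ A i, IsDescendant T r x (top i) := fun i ↦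
    isDescendant_of_induce_preconnected hT (hA i).preconnected (fun _ ↦ hmin i) (htop i)
      (isDescendant_self hT)
  obtain ⟨_, ⟨i, rfl⟩, hdeepest⟩ := (Set.range top).exists_max_image (T.dist r)
    (Set.range top).toFinite (Set.range_nonempty top)
  -- A subtree that meets `A i` but avoids `top i` would have its top strictly below `top i`.
  refine ⟨i, top i, fun j hij ↦ ?_⟩
  obtain ⟨x, hxi, hxj⟩ := Set.not_disjoint_iff.1 hij
  by_contra ht
  have hj : IsDescendant T r (top j) (top i) :=
    isDescendant_of_induce_preconnected hT (hA j).preconnected (fun h ↦ absurd h ht) hxj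
      (hdesc i x hxi) (top j) (htop j)
  exact (hj.dist_lt hT fun h ↦ ht (h ▸ htop j)).not_ge (hdeepest _ ⟨j, rfl⟩)

theorem exists_pairwise_disjoint_or_cover_of_isTree [Finite N] (hT : T.IsTree) (k : ℕ)
    {ι : Type*} (A : ι → Set N) (hA : ∀ i, (T.induce (A i)).Connected) :
    (∃ f : Fin (k + 1) → ι, Pairwise (Disjoint on A ∘ f)) ∨
      ∃ X : Finset N, #X ≤ k ∧ ∀ i, ∃ x ∈ X, x ∈ A i := by
  classical
  induction k generalizing ι with
  | zero =>
    obtain hι | ⟨⟨i⟩⟩ := isEmpty_or_nonempty ι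
    · exact .inr ⟨∅, le_rfl, hι.elim⟩
    · exact .inl ⟨fun _ ↦ i, fun a b hab ↦ (hab (Subsingleton.elim (α := Fin 1) a b)).elim⟩
  | succ k ih =>
    obtain hι | hι := isEmpty_or_nonempty ι
    · exact .inr ⟨∅, Nat.zero_le _, hι.elim⟩
    obtain ⟨i, t, hit⟩ := exists_forall_not_disjoint_imp_mem hT hA
    obtain ⟨f, hf⟩ | ⟨X, hX, hcov⟩ := ih (fun j : {j // t ∉ A j} ↦ A j) (fun j ↦ hA j)
    · have hi : ∀ a, Disjoint (A i) (A (f a)) := fun a ↦ not_not.1 fun h ↦ (f a).2 (hit _ h)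
      refine .inl ⟨Fin.cons i fun a ↦ f a, fun a b hab ↦ ?_⟩
      cases a using Fin.cases with
      | zero =>
        cases b using Fin.cases with
        | zero => exact absurd rfl hab
        | succ b => exact hi b
      | succ a =>
        cases b using Fin.cases with
        | zero => exact (hi a).symm
        | succ b => exact hf fun h ↦ hab (congrArg Fin.succ h)
    · refine .inr ⟨insert t X, (Finset.card_insert_le t X).trans (Nat.succ_le_succ hX), fun j ↦ ?_⟩
      by_cases hj : t ∈ A j
      · exact ⟨t, Finset.mem_insert_self t X, hj⟩
      · obtain ⟨x, hxX, hxj⟩ := hcov ⟨j, hj⟩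
        exact ⟨x, Finset.mem_insert_of_mem hxX, hxj⟩

end Tree

namespace TreeDecomposition

variable {V : Type*} {G : SimpleGraph V}

theorem card_bag_le (D : TreeDecomposition G) {w : ℕ} (hD : D.width ≤ w) (x : D.Node) :
    #(D.bag x) ≤ w + 1 := by
  have hx : #(D.bag x) ≤ Finset.univ.sup fun y ↦ #(D.bag y) :=
    Finset.le_sup (f := fun y ↦ #(D.bag y)) (Finset.mem_univ x)
  rw [width] at hD
  omega

theorem induce_nodes_connected (D : TreeDecomposition G) {A : Set V}
    (hA : (G.induce A).Connected) : (D.tree.induce {x | ∃ v ∈ A, v ∈ D.bag x}).Connected := by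
  have hunion : (D.tree.induce (⋃ v : A, {x | (v : V) ∈ D.bag x})).Connected := by
    refine induce_iUnion_connected hA (fun v ↦ D.connected v) fun u v huv ↦ ?_
    obtain ⟨x, hxu, hxv⟩ := D.edge_mem u v huv
    exact induce_union_connected (D.connected u).preconnected (D.connected v).preconnected
      ⟨x, hxu, hxv⟩
  have hset : (⋃ v : A, {x | (v : V) ∈ D.bag x}) = {x | ∃ v ∈ A, v ∈ D.bag x} := by
    ext x
    simp
  rwa [hset] at hunion

theorem exists_pairwise_disjoint_or_cover (D : TreeDecomposition G) {b : ℕ}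
    (hb : ∀ x, #(D.bag x) ≤ b) (k : ℕ) {ι : Type*} (A : ι → Set V)
    (hA : ∀ i, (G.induce (A i)).Connected) :
    (∃ f : Fin (k + 1) → ι, Pairwise (Disjoint on A ∘ f)) ∨
      ∃ X : Finset V, #X ≤ k * b ∧ ∀ i, ∃ v ∈ X, v ∈ A i := by
  classical
  obtain ⟨f, hf⟩ | ⟨X, hX, hcov⟩ := exists_pairwise_disjoint_or_cover_of_isTree D.isTree k
    (fun i ↦ {x | ∃ v ∈ A i, v ∈ D.bag x}) fun i ↦ D.induce_nodes_connected (hA i)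
  · refine .inl ⟨f, fun i j hij ↦ Set.disjoint_left.2 fun v hvi hvj ↦ ?_⟩
    obtain ⟨⟨x, hx⟩⟩ := (D.connected v).nonempty
    exact Set.disjoint_left.1 (hf hij) ⟨v, hvi, hx⟩ ⟨v, hvj, hx⟩
  · refine .inr ⟨X.biUnion D.bag, (Finset.card_biUnion_le_card_mul X D.bag b fun x _ ↦ hb x).trans
      (Nat.mul_le_mul_right b hX), fun i ↦ ?_⟩
    obtain ⟨x, hx, v, hv, hvx⟩ := hcov i
    exact ⟨v, Finset.mem_biUnion.2 ⟨x, hx, hvx⟩, hv⟩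

end TreeDecomposition

section OddModel

variable {V W W' ι : Type*} {G : SimpleGraph V} {H : SimpleGraph W} {H' : SimpleGraph W'}

/-- The subgraph of `G` formed by the edges whose ends have different colours: a branch set is
spanned by a properly coloured tree iff it induces a connected subgraph here. -/
def bichromatic (G : SimpleGraph V) (c : V → Bool) : SimpleGraph V :=
  G ⊓ (⊤ : SimpleGraph Bool).comap c

theorem bichromatic_le (c : V → Bool) : bichromatic G c ≤ G :=
  inf_le_left

theorem connected_induce_of_bichromatic {c : V → Bool} {A : Set V}
    (hA : ((bichromatic G c).induce A).Connected) : (G.induce A).Connected :=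
  hA.mono (comap_monotone _ (bichromatic_le c))

theorem bichromatic_induce_congr {c c' : V → Bool} {A : Set V} (hc : Set.EqOn c c' A) :
    (bichromatic G c).induce A = (bichromatic G c').induce A := by
  ext u v
  simp [bichromatic, hc u.2, hc v.2]

theorem exists_mem_color_eq {c : V → Bool} {A : Set V} (hA : A.Nontrivial)
    (hconn : ((bichromatic G c).induce A).Connected) (β : Bool) : ∃ v ∈ A, c v = β := by
  obtain ⟨a, ha⟩ := hA.nonempty
  obtain ⟨b, hb, -, hab⟩ := exists_adj_of_induce_preconnected hconn.preconnected hA ha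
  obtain h | h := Bool.eq_or_eq_not (c a) β
  · exact ⟨a, ha, h⟩
  · exact ⟨b, hb, by simpa [h] using hab.symm⟩

/-- The sets `B x` are the vertex sets of the branch trees of a non-trivial odd `H`-model in `G`,
with 2-colouring `c`. -/
structure IsOddBranchFamily (G : SimpleGraph V) (H : SimpleGraph W) (c : V → Bool)
    (B : W → Set V) : Prop where
  nontrivial : ∀ x, (B x).Nontrivial
  connected : ∀ x, ((bichromatic G c).induce (B x)).Connected
  disjoint : Pairwise (Disjoint on B)
  exists_adj : ∀ x y, H.Adj x y → ∃ u ∈ B x, ∃ v ∈ B y, G.Adj u v ∧ c u = c v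

/-- `G` contains a non-trivial odd `H`-model all of whose branch trees lie in `S`. -/
def HasOddModelIn (G : SimpleGraph V) (H : SimpleGraph W) (S : Set V) : Prop :=
  ∃ c B, IsOddBranchFamily G H c B ∧ ∀ x, B x ⊆ S

theorem IsOddBranchFamily.congr {c c' : V → Bool} {B : W → Set V}
    (h : IsOddBranchFamily G H c B) (hc : ∀ x, Set.EqOn c' c (B x)) :
    IsOddBranchFamily G H c' B where
  nontrivial := h.nontrivial
  connected x := bichromatic_induce_congr (G := G) (hc x) ▸ h.connected x
  disjoint := h.disjoint
  exists_adj x y hxy := by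
    obtain ⟨u, hu, v, hv, huv, hcuv⟩ := h.exists_adj x y hxy
    exact ⟨u, hu, v, hv, huv, by rw [hc x hu, hc y hv, hcuv]⟩

theorem HasOddModelIn.mono {S S' : Set V} (h : HasOddModelIn G H S) (hS : S ⊆ S') :
    HasOddModelIn G H S' := by
  obtain ⟨c, B, hB, hBS⟩ := h
  exact ⟨c, B, hB, fun x ↦ (hBS x).trans hS⟩

theorem HasOddModelIn.of_isContained {S : Set V} (h : HasOddModelIn G H' S) (hH : H ⊑ H') :
    HasOddModelIn G H S := by
  obtain ⟨c, B, hB, hBS⟩ := h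
  obtain ⟨f⟩ := hH
  exact ⟨c, B ∘ f, ⟨fun x ↦ hB.nontrivial _, fun x ↦ hB.connected _,
    fun x y hxy ↦ hB.disjoint (f.injective.ne hxy),
    fun x y hxy ↦ hB.exists_adj _ _ (f.toHom.map_adj hxy)⟩, fun x ↦ hBS _⟩

theorem HasOddModelIn.exists_connected {S : Set V} (h : HasOddModelIn G H S)
    (hH : H.Connected) : ∃ A ⊆ S, (G.induce A).Connected ∧ HasOddModelIn G H A := by
  obtain ⟨c, B, hB, hBS⟩ := h
  have hconn x := connected_induce_of_bichromatic (hB.connected x)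
  refine ⟨⋃ x, B x, Set.iUnion_subset hBS, induce_iUnion_connected hH hconn fun x y hxy ↦ ?_,
    c, B, hB, Set.subset_iUnion B⟩
  obtain ⟨u, hu, v, hv, huv, -⟩ := hB.exists_adj x y hxy
  exact connected_induce_union (hconn x).preconnected (hconn y).preconnected hu hv huv

theorem HasOddModelIn.of_adj [Subsingleton W] {S : Set V} {u v : V} (hu : u ∈ S) (hv : v ∈ S)
    (huv : G.Adj u v) : HasOddModelIn G H S := by
  classical
  have hadj : (bichromatic G fun z ↦ decide (z = u)).Adj u v := ⟨huv, by simp [huv.ne.symm]⟩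
  exact ⟨fun z ↦ decide (z = u), fun _ ↦ {u, v}, ⟨fun _ ↦ Set.nontrivial_pair huv.ne,
    fun _ ↦ induce_pair_connected_of_adj hadj, fun x y hxy ↦ absurd (Subsingleton.elim x y) hxy,
    fun x y hxy ↦ absurd (Subsingleton.elim x y) hxy.ne⟩, fun _ ↦ Set.pair_subset hu hv⟩

theorem exists_subgraph_isTree {G' : SimpleGraph V} (hG : G' ≤ G) {A : Set V}
    (hA : (G'.induce A).Connected) :
    ∃ T : G.Subgraph, T.verts = A ∧ T.coe.IsTree ∧ ∀ u v, T.Adj u v → G'.Adj u v := by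
  obtain ⟨t, ht, htree⟩ := hA.exists_isTree_le
  have hle : t.spanningCoe ≤ G' := (SimpleGraph.map_le_iff_le_comap _ _ _).2 ht
  let T : G.Subgraph := (toSubgraph t.spanningCoe (hle.trans hG)).induce A
  have hT : T.coe = t.spanningCoe.induce A := by
    ext u v
    exact ⟨fun huv ↦ huv.2.2, fun huv ↦ ⟨u.2, v.2, huv⟩⟩
  exact ⟨T, rfl, hT.trans induce_spanningCoe ▸ htree, fun u v huv ↦ hle huv.2.2⟩

theorem HasOddModelIn.exists_model (h : HasOddModelIn G H Set.univ) :
    ∃ M : Model H G, M.IsNontrivial ∧ M.IsOdd := by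
  obtain ⟨c, B, hB, -⟩ := h
  choose T hverts htree hadj using fun x ↦
    exists_subgraph_isTree (bichromatic_le c) (hB.connected x)
  let M : Model H G :=
    { T := T
      isTree := htree
      disjoint := fun x y hxy ↦ by simpa only [hverts] using hB.disjoint hxy
      exists_adj := fun x y hxy ↦ by
        obtain ⟨u, hu, v, hv, huv, -⟩ := hB.exists_adj x y hxy
        exact ⟨u, (hverts x).symm ▸ hu, v, (hverts y).symm ▸ hv, huv⟩ }
  refine ⟨M, fun x ↦ (hverts x).symm ▸ hB.nontrivial x, fun v ↦ c v,
    fun x u v huv ↦ (hadj x u v huv).2, fun x y hxy ↦ ?_⟩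
  obtain ⟨u, hu, v, hv, huv, hc⟩ := hB.exists_adj x y hxy
  rw [← hverts] at hu hv
  exact ⟨⟨u, x, hu⟩, ⟨v, y, hv⟩, hu, hv, .inr ⟨x, y, hxy, hu, hv, huv⟩, hc⟩

end OddModel

section Cone

variable {V W ι : Type*} {G : SimpleGraph V} {H : SimpleGraph W}

/-- The cone over the disjoint union of copies of `H` indexed by `ι`: the apex `none` is adjacent
to every vertex of every copy. -/
def coneCopies (ι : Type*) (H : SimpleGraph W) : SimpleGraph (Option (ι × W)) where
  Adj
    | none, none => False
    | none, some _ => True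
    | some _, none => True
    | some p, some q => p.1 = q.1 ∧ H.Adj p.2 q.2
  symm := ⟨by
    rintro (_ | p) (_ | q) h
    exacts [h, h, h, ⟨h.1.symm, h.2.symm⟩]⟩
  loopless := ⟨by
    rintro (_ | p) h
    exacts [h, h.2.ne rfl]⟩

theorem pairwise_disjoint_option_elim {R : Set V} {A : ι → Set V} (hA : Pairwise (Disjoint on A))
    (hR : ∀ i, Disjoint R (A i)) : Pairwise (Disjoint on fun o : Option ι ↦ o.elim R A) := by
  rintro (_ | i) (_ | j) hij
  exacts [absurd rfl hij, hR j, (hR i).symm, hA fun h ↦ hij (congrArg some h)]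

theorem IsOddBranchFamily.cone {c : V → Bool} {R : Set V} {B : ι → W → Set V}
    (hR : R.Nontrivial) (hRconn : ((bichromatic G c).induce R).Connected)
    (hB : ∀ i, IsOddBranchFamily G H c (B i))
    (hdisj : Pairwise (Disjoint on fun i ↦ ⋃ x, B i x)) (hRB : ∀ i x, Disjoint R (B i x))
    (hadj : ∀ i x, ∃ u ∈ R, ∃ v ∈ B i x, G.Adj u v ∧ c u = c v) :
    IsOddBranchFamily G (coneCopies ι H) c fun o ↦ o.elim R fun p ↦ B p.1 p.2 where
  nontrivial := by
    rintro (_ | ⟨i, x⟩)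
    exacts [hR, (hB i).nontrivial x]
  connected := by
    rintro (_ | ⟨i, x⟩)
    exacts [hRconn, (hB i).connected x]
  disjoint := by
    refine pairwise_disjoint_option_elim ?_ fun p ↦ hRB p.1 p.2
    rintro ⟨i, x⟩ ⟨j, y⟩ hne
    obtain rfl | hij := eq_or_ne i j
    · exact (hB i).disjoint fun h ↦ hne (congrArg (Prod.mk i) h)
    · exact (hdisj hij).mono (Set.subset_iUnion _ x) (Set.subset_iUnion _ y)
  exists_adj := by
    rintro (_ | ⟨i, x⟩) (_ | ⟨j, y⟩) h
    · exact h.elim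
    · exact hadj j y
    · obtain ⟨u, hu, v, hv, huv, hc⟩ := hadj i x
      exact ⟨v, hv, u, hu, huv.symm, hc.symm⟩
    · obtain ⟨rfl, hxy⟩ := h
      exact (hB i).exists_adj x y hxy

theorem HasOddModelIn.cone {c : V → Bool} {R : Set V} (hR : R.Nontrivial)
    (hRconn : ((bichromatic G c).induce R).Connected) {A : ι → Set V}
    (hA : ∀ i, HasOddModelIn G H (A i)) (hdisj : Pairwise (Disjoint on A))
    (hRA : ∀ i, Disjoint R (A i)) {β : Bool}
    (hadj : ∀ i, ∀ v ∈ A i, ∃ u ∈ R, c u = β ∧ G.Adj u v) :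
    HasOddModelIn G (coneCopies ι H) (R ∪ ⋃ i, A i) := by
  choose cA B hB hBA using hA
  obtain ⟨g, hg⟩ := exists_forall_eqOn (pairwise_disjoint_option_elim hdisj hRA)
    fun o ↦ o.elim c cA
  have hgR : Set.EqOn g c R := hg none
  have hgA : ∀ i, Set.EqOn g (cA i) (A i) := fun i ↦ hg (some i)
  have hB' : ∀ i, IsOddBranchFamily G H g (B i) := fun i ↦
    (hB i).congr fun x ↦ (hgA i).mono (hBA i x)
  refine ⟨g, _, .cone hR (bichromatic_induce_congr (G := G) hgR ▸ hRconn) hB' ?_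
    (fun i x ↦ (hRA i).mono_right (hBA i x)) fun i x ↦ ?_, ?_⟩
  · exact fun i j hij ↦ (hdisj hij).mono (Set.iUnion_subset (hBA i)) (Set.iUnion_subset (hBA j))
  · obtain ⟨v, hv, hvβ⟩ := exists_mem_color_eq ((hB' i).nontrivial x) ((hB' i).connected x) β
    obtain ⟨u, hu, huβ, huv⟩ := hadj i v (hBA i x hv)
    exact ⟨u, hu, v, hv, huv, by rw [hgR hu, huβ, hvβ]⟩
  · rintro (_ | ⟨i, x⟩)
    · exact Set.subset_union_left
    · exact (hBA i x).trans (Set.subset_union_of_subset_right (Set.subset_iUnion A i) R)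

/-- The bijection from the vertices of the cone over `d` complete `d`-ary trees to those of the
`d`-ary tree one level higher. Words are read from the right, so the copy containing a word is
its last letter. -/
def consTop (n d : ℕ) : Option (Fin d × Word (n + 1) d) → Word (n + 2) d
  | none => root _ _
  | some (i, l) => ⟨l.1 ++ [i], by simpa using l.2⟩

theorem consTop_bijective (n d : ℕ) : Function.Bijective (consTop n d) := by
  constructor
  · rintro (_ | ⟨i, l⟩) (_ | ⟨j, m⟩) h
    · rfl
    · simp [consTop, root] at h
    · simp [consTop, root] at h
    · obtain ⟨hlm, rfl⟩ := List.append_singleton_inj.1 (congrArg Subtype.val h)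
      rw [Subtype.ext hlm]
  · rintro ⟨l, hl⟩
    obtain rfl | ⟨l, i, rfl⟩ := List.eq_nil_or_concat' l
    · exact ⟨none, rfl⟩
    · exact ⟨some (i, ⟨l, by simpa using hl⟩), rfl⟩

theorem concat_suffix_concat_iff {α : Type*} {l m : List α} {a b : α} :
    l ++ [a] <:+ m ++ [b] ↔ a = b ∧ l <:+ m := by
  rw [List.suffix_concat_iff]
  aesop

theorem coneCopies_adj_of_U_adj_consTop {n d : ℕ} {x y : Option (Fin d × Word (n + 1) d)}
    (h : (U (n + 2) d).Adj (consTop n d x) (consTop n d y)) :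
    (coneCopies (Fin d) (U (n + 1) d)).Adj x y := by
  obtain _ | ⟨i, l⟩ := x <;> obtain _ | ⟨j, m⟩ := y
  · exact h.ne rfl
  · trivial
  · trivial
  · obtain ⟨hne, hsuf⟩ := (U_adj _ _).1 h
    simp only [consTop, concat_suffix_concat_iff] at hsuf
    obtain rfl : i = j := hsuf.elim (fun h ↦ h.1.symm) And.left
    exact ⟨rfl, (U_adj l m).2 ⟨fun hlm ↦ hne (hlm ▸ rfl), hsuf.imp And.right And.right⟩⟩

theorem U_isContained_coneCopies (n d : ℕ) : U (n + 2) d ⊑ coneCopies (Fin d) (U (n + 1) d) :=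
  let e := Equiv.ofBijective _ (consTop_bijective n d)
  ⟨⟨⟨e.symm, fun {x y} h ↦ coneCopies_adj_of_U_adj_consTop <|
    (congrArg₂ _ (e.apply_symm_apply x) (e.apply_symm_apply y)).mpr h⟩, e.symm.injective⟩⟩

theorem U_connected (n d : ℕ) : (U n d).Connected := by
  refine (connected_iff_exists_forall_reachable _).2 ⟨root n d, fun l ↦ ?_⟩
  obtain rfl | hl := eq_or_ne (root n d) l
  · exact .refl _
  · exact Adj.reachable ((U_adj _ _).2 ⟨hl, .inr List.nil_suffix⟩)

instance (d : ℕ) : Subsingleton (Word 1 d) :=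
  ⟨fun l l' ↦ Subtype.ext <|
    (List.length_eq_zero_iff.1 (Nat.le_zero.1 l.2)).trans
      (List.length_eq_zero_iff.1 (Nat.le_zero.1 l'.2)).symm⟩

end Cone

section Layers

variable {V W ι : Type*} {G : SimpleGraph V} {H : SimpleGraph W} {S : Set V} {r : V}

/-- The distance from `r` to `v` in the subgraph of `G` induced by `S`. It takes a junk value if
`r` and `v` are not joined by a walk inside `S`. -/
noncomputable def distIn (G : SimpleGraph V) (S : Set V) (r v : V) : ℕ :=
  (G.induce S).spanningCoe.dist r v

theorem distIn_le_succ {u v : V} (hu : u ∈ S) (hv : v ∈ S) (huv : G.Adj u v) :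
    distIn G S r v ≤ distIn G S r u + 1 := by
  have hadj : (G.induce S).spanningCoe.Adj u v := by simp [hu, hv, huv]
  have := hadj.diff_dist_adj (u := r)
  unfold distIn
  omega

theorem exists_adj_distIn_eq_succ (hS : (G.induce S).Connected) (hr : r ∈ S) {v : V} (hv : v ∈ S)
    (hne : v ≠ r) : ∃ u ∈ S, G.Adj u v ∧ distIn G S r v = distIn G S r u + 1 := by
  have hreach : (G.induce S).spanningCoe.Reachable v r :=
    (hS.preconnected ⟨v, hv⟩ ⟨r, hr⟩).map (Embedding.spanningCoe _).toHom
  obtain ⟨p, hp⟩ := hreach.exists_walk_length_eq_dist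
  cases p with
  | nil => exact absurd rfl hne
  | @cons _ u _ hvu q =>
    obtain ⟨hvu, -, hu⟩ : G.Adj v u ∧ v ∈ S ∧ u ∈ S := by simpa using hvu
    refine ⟨u, hu, hvu.symm, (distIn_le_succ hu hv hvu.symm).antisymm ?_⟩
    rw [Walk.length_cons, SimpleGraph.dist_comm] at hp
    rw [distIn, distIn, ← hp, SimpleGraph.dist_comm]
    exact Nat.succ_le_succ (SimpleGraph.dist_le q)

theorem bichromatic_induce_connected_of_distIn (hS : (G.induce S).Connected) {A : Set V}
    (hrA : r ∈ A) (hAS : A ⊆ S) {i : ℕ} (hlower : ∀ v ∈ S, distIn G S r v < i → v ∈ A)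
    (hupper : ∀ v ∈ A, distIn G S r v ≤ i) :
    ((bichromatic G fun v ↦ (distIn G S r v).bodd).induce A).Connected := by
  refine induce_connected_of_descent hrA (distIn G S r) fun v hv hvr ↦ ?_
  obtain ⟨u, hu, huv, hdist⟩ := exists_adj_distIn_eq_succ hS (hAS hrA) (hAS hv) hvr
  refine ⟨u, hlower u hu ?_, ⟨huv, ?_⟩, ?_⟩
  · exact Nat.lt_of_succ_le (hdist.symm.trans_le (hupper v hv))
  · simp [hdist]
  · omega

theorem hasOddModelIn_coneCopies_of_layer (hS : (G.induce S).Connected) (hr : r ∈ S) {v₁ : V}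
    (hv₁ : v₁ ∈ S) (hne : v₁ ≠ r) {A : ι → Set V} (hA : ∀ j, HasOddModelIn G H (A j))
    (hdisj : Pairwise (Disjoint on A))
    (hlayer : ∀ j, A j ⊆ {v ∈ S | distIn G S r v = distIn G S r v₁} \ {v₁}) :
    HasOddModelIn G (coneCopies ι H) S := by
  obtain ⟨u₁, -, -, hu₁⟩ := exists_adj_distIn_eq_succ hS hr hv₁ hne
  have hlt : distIn G S r r < distIn G S r v₁ := by
    have hrr : distIn G S r r = 0 := SimpleGraph.dist_self
    omega
  -- The layers below `v₁` may consist of `r` alone; adding `v₁` makes the apex set non-trivial.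
  let R : Set V := insert v₁ {v ∈ S | distIn G S r v < distIn G S r v₁}
  have hrR : r ∈ R := .inr ⟨hr, hlt⟩
  have hRS : R ⊆ S := Set.insert_subset hv₁ (Set.sep_subset _ _)
  have hRconn : ((bichromatic G fun v ↦ (distIn G S r v).bodd).induce R).Connected := by
    refine bichromatic_induce_connected_of_distIn hS hrR hRS (fun v hv h ↦ .inr ⟨hv, h⟩) ?_
    rintro v (rfl | ⟨-, hv⟩)
    exacts [le_rfl, hv.le]
  have hRA : ∀ j, Disjoint R (A j) := fun j ↦ Set.disjoint_left.2 <| by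
    rintro v (rfl | ⟨-, hv⟩) hvA
    exacts [(hlayer j hvA).2 rfl, hv.ne (hlayer j hvA).1.2]
  suffices HasOddModelIn G (coneCopies ι H) (R ∪ ⋃ j, A j) from
    this.mono (Set.union_subset hRS (Set.iUnion_subset fun j v hv ↦ (hlayer j hv).1.1))
  refine .cone (β := (distIn G S r u₁).bodd) ⟨r, hrR, v₁, .inl rfl, hne.symm⟩ hRconn hA hdisj hRA
    fun j v hv ↦ ?_
  obtain ⟨⟨hvS, hdist⟩, -⟩ := hlayer j hv
  obtain ⟨u, hu, huv, hdist'⟩ := exists_adj_distIn_eq_succ hS hr hvS fun h ↦ hlt.ne (h ▸ hdist)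
  exact ⟨u, .inr ⟨hu, by omega⟩, congrArg _ (by omega), huv⟩

theorem TreeDecomposition.exists_disjoint_oddModels_or_cover (D : TreeDecomposition G) {b : ℕ}
    (hb : ∀ x, #(D.bag x) ≤ b) (hH : H.Connected) (k : ℕ) (S : Set V) :
    (∃ A : Fin (k + 1) → Set V, Pairwise (Disjoint on A) ∧
      ∀ j, A j ⊆ S ∧ HasOddModelIn G H (A j)) ∨
    ∃ X : Finset V, #X ≤ k * b ∧ ¬HasOddModelIn G H (S \ X) := by
  let F : Set (Set V) := {A | A ⊆ S ∧ (G.induce A).Connected ∧ HasOddModelIn G H A}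
  obtain ⟨f, hf⟩ | ⟨X, hX, hcov⟩ :=
    D.exists_pairwise_disjoint_or_cover hb k (fun A : F ↦ (A : Set V)) fun A ↦ A.2.2.1
  · exact .inl ⟨fun j ↦ f j, hf, fun j ↦ ⟨(f j).2.1, (f j).2.2.2⟩⟩
  · refine .inr ⟨X, hX, fun h ↦ ?_⟩
    obtain ⟨A, hAS, hconn, hA⟩ := h.exists_connected hH
    obtain ⟨v, hvX, hvA⟩ := hcov ⟨A, hAS.trans Set.sdiff_subset, hconn, hA⟩
    exact (hAS hvA).2 hvX

theorem TreeDecomposition.exists_cover_layer (D : TreeDecomposition G) {b : ℕ}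
    (hb : ∀ x, #(D.bag x) ≤ b) (hH : H.Connected) {k : ℕ} (hS : (G.induce S).Connected)
    (hr : r ∈ S) (hcone : ¬HasOddModelIn G (coneCopies (Fin (k + 1)) H) S) (i : ℕ) :
    ∃ X : Finset V, #X ≤ k * b + 1 ∧ ¬HasOddModelIn G H ({v ∈ S | distIn G S r v = i} \ X) := by
  classical
  by_cases hi : ∃ v₁ ∈ S, v₁ ≠ r ∧ distIn G S r v₁ = i
  · obtain ⟨v₁, hv₁, hne, rfl⟩ := hi
    obtain ⟨A, hdisj, hA⟩ | ⟨X, hX, hfree⟩ := D.exists_disjoint_oddModels_or_cover hb hH k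
      ({v ∈ S | distIn G S r v = distIn G S r v₁} \ {v₁})
    · exact absurd (hasOddModelIn_coneCopies_of_layer hS hr hv₁ hne (fun j ↦ (hA j).2) hdisj
        fun j ↦ (hA j).1) hcone
    · refine ⟨insert v₁ X, (Finset.card_insert_le v₁ X).trans (Nat.succ_le_succ hX), ?_⟩
      rwa [Finset.coe_insert, Set.insert_eq, ← Set.sdiff_sdiff]
  · refine ⟨{r}, by simp, fun h ↦ ?_⟩
    obtain ⟨A, hA, hconn, -⟩ := h.exists_connected hH
    obtain ⟨⟨v, hv⟩⟩ := hconn.nonempty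
    obtain ⟨⟨hvS, hvi⟩, hvr⟩ := hA hv
    exact hi ⟨v, hvS, by simpa using hvr, hvi⟩

end Layers

section ClusteredColouring

variable {V W α : Type*} {G : SimpleGraph V} {H : SimpleGraph W} {S : Set V} {N m : ℕ}

/-- The colouring `c` has clustering `m` on the subgraph of `G` induced by `S`. Quantifying over
all monochromatic connected sets, and not only over components, makes this monotone in `S`. -/
def ClusteredOn (G : SimpleGraph V) (S : Set V) (c : V → α) (m : ℕ) : Prop :=
  ∀ A ⊆ S, (G.induce A).Connected → (∀ u ∈ A, ∀ v ∈ A, c u = c v) → A.ncard ≤ m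

theorem ClusteredOn.mono {c : V → α} {m' : ℕ} (h : ClusteredOn G S c m) (hm : m ≤ m') :
    ClusteredOn G S c m' :=
  fun A hAS hA hmono ↦ (h A hAS hA hmono).trans hm

theorem ClusteredOn.hasClustering {c : V → α} (h : ClusteredOn G Set.univ c m) :
    HasClustering G c m := by
  intro i C
  rw [← Set.ncard_image_of_injective _ Subtype.val_injective]
  refine h _ (Set.subset_univ _) (induce_image_supp_connected C) ?_
  rintro _ ⟨u, -, rfl⟩ _ ⟨v, -, rfl⟩
  exact u.2.trans v.2.symm

theorem exists_image_supp_superset {A : Set V} (hAS : A ⊆ S) (hA : (G.induce A).Connected) :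
    ∃ C : (G.induce S).ConnectedComponent, A ⊆ Subtype.val '' C.supp := by
  obtain ⟨⟨a, ha⟩⟩ := hA.nonempty
  exact ⟨(G.induce S).connectedComponentMk ⟨a, hAS ha⟩, fun v hv ↦ ⟨⟨v, hAS hv⟩,
    ConnectedComponent.sound (reachable_induce_mono hA.preconnected hAS hv ha), rfl⟩⟩

theorem exists_clusteredOn_of_connected [Nonempty α]
    (h : ∀ K ⊆ S, (G.induce K).Connected → ∃ c : V → α, ClusteredOn G K c m) :
    ∃ c : V → α, ClusteredOn G S c m := by
  let K : (G.induce S).ConnectedComponent → Set V := fun C ↦ Subtype.val '' C.supp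
  have hK : Pairwise (Disjoint on K) := fun C C' hne ↦
    (Set.disjoint_image_iff Subtype.val_injective).2
      (pairwise_disjoint_supp_connectedComponent _ hne)
  choose c hc using fun C ↦
    h (K C) (Subtype.coe_image_subset _ _) (induce_image_supp_connected C)
  obtain ⟨g, hg⟩ := exists_forall_eqOn hK c
  refine ⟨g, fun A hAS hA hmono ↦ ?_⟩
  obtain ⟨C, hAC⟩ := exists_image_supp_superset hAS hA
  refine hc C A hAC hA fun u hu v hv ↦ ?_
  rw [← hg C (hAC hu), ← hg C (hAC hv)]
  exact hmono u hu v hv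

theorem ClusteredOn.exists_extend {X : Finset V} {c : V → Fin N} (h : ClusteredOn G (S \ X) c m)
    (hX : #X ≤ m) : ∃ c' : V → Fin (N + 1), ClusteredOn G S c' m := by
  classical
  refine ⟨fun v ↦ if v ∈ X then Fin.last N else (c v).castSucc, fun A hAS hA hmono ↦ ?_⟩
  by_cases hAX : ∃ a ∈ A, a ∈ X
  · obtain ⟨a, ha, haX⟩ := hAX
    have hsub : A ⊆ X := fun v hv ↦ by
      by_contra hvX
      have hva := hmono v hv a ha
      simp only [if_pos haX, if_neg (show v ∉ X from hvX)] at hva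
      exact (Fin.castSucc_lt_last _).ne hva
    exact (Set.ncard_le_ncard hsub X.finite_toSet).trans (by rwa [Set.ncard_coe_finset])
  · push Not at hAX
    refine h A (fun v hv ↦ ⟨hAS hv, hAX v hv⟩) hA fun u hu v hv ↦ ?_
    have huv := hmono u hu v hv
    simp only [if_neg (hAX u hu), if_neg (hAX v hv)] at huv
    exact Fin.castSucc_injective N huv

theorem exists_clusteredOn_of_layers {δ : V → ℕ}
    (hδ : ∀ u ∈ S, ∀ v ∈ S, G.Adj u v → δ v ≤ δ u + 1)
    (h : ∀ i, ∃ c : V → Fin N, ClusteredOn G {v ∈ S | δ v = i} c m) :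
    ∃ c : V → Fin (2 * N), ClusteredOn G S c m := by
  choose c hc using h
  refine ⟨fun v ↦ finProdFinEquiv (⟨δ v % 2, Nat.mod_lt _ two_pos⟩, c (δ v) v),
    fun A hAS hA hmono ↦ ?_⟩
  have hpair : ∀ u ∈ A, ∀ v ∈ A, δ u % 2 = δ v % 2 ∧ c (δ u) u = c (δ v) v := fun u hu v hv ↦ by
    simpa using hmono u hu v hv
  obtain ⟨⟨a, ha⟩⟩ := hA.nonempty
  have hlayer : A ⊆ {v | δ v = δ a} :=
    subset_of_induce_preconnected hA.preconnected ha rfl fun u hu (hua : δ u = δ a) v hv huv ↦ by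
      have huv' := hδ u (hAS hu) v (hAS hv) huv
      have hvu' := hδ v (hAS hv) u (hAS hu) huv.symm
      have hpar := (hpair u hu v hv).1
      change δ v = δ a
      omega
  refine hc (δ a) A (fun v hv ↦ ⟨hAS hv, hlayer hv⟩) hA fun u hu v hv ↦ ?_
  have huv := (hpair u hu v hv).2
  rwa [hlayer hu, hlayer hv] at huv

theorem clusteredOn_one_of_forall_not_adj {c : V → α} (hS : ∀ u ∈ S, ∀ v ∈ S, ¬G.Adj u v) :
    ClusteredOn G S c 1 := by
  intro A hAS hA _
  by_contra! hcard
  have hnt : A.Nontrivial := (Set.one_lt_ncard_iff_nontrivial_and_finite.1 hcard).1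
  obtain ⟨a, ha⟩ := hnt.nonempty
  obtain ⟨b, hb, hab⟩ := exists_adj_of_induce_preconnected hA.preconnected hnt ha
  exact hS a (hAS ha) b (hAS hb) hab

theorem TreeDecomposition.exists_clusteredOn_of_not_hasOddModelIn_coneCopies
    (D : TreeDecomposition G) {b : ℕ} (hb : ∀ x, #(D.bag x) ≤ b) (hH : H.Connected) {k : ℕ}
    (ih : ∀ S, ¬HasOddModelIn G H S → ∃ c : V → Fin N, ClusteredOn G S c (k * b + 1))
    (hS : ¬HasOddModelIn G (coneCopies (Fin (k + 1)) H) S) :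
    ∃ c : V → Fin (2 * (N + 1)), ClusteredOn G S c (k * b + 1) := by
  refine exists_clusteredOn_of_connected fun K hKS hK ↦ ?_
  obtain ⟨⟨r, hr⟩⟩ := hK.nonempty
  refine exists_clusteredOn_of_layers (δ := distIn G K r)
    (fun u hu v hv ↦ distIn_le_succ hu hv) fun i ↦ ?_
  obtain ⟨X, hX, hfree⟩ := D.exists_cover_layer hb hH hK hr (fun h ↦ hS (h.mono hKS)) i
  obtain ⟨c, hc⟩ := ih _ hfree
  exact hc.exists_extend hX

theorem TreeDecomposition.exists_clusteredOn_of_not_hasOddModelIn_U (D : TreeDecomposition G)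
    {b : ℕ} (hb : ∀ x, #(D.bag x) ≤ b) (k n : ℕ)
    (hS : ¬HasOddModelIn G (U (n + 1) (k + 1)) S) :
    ∃ c : V → Fin (3 * 2 ^ n - 2), ClusteredOn G S c (k * b + 1) := by
  induction n generalizing S with
  | zero =>
    have hedgeless : ∀ u ∈ S, ∀ v ∈ S, ¬G.Adj u v := fun u hu v hv huv ↦ hS (.of_adj hu hv huv)
    exact ⟨fun _ ↦ ⟨0, one_pos⟩,
      (clusteredOn_one_of_forall_not_adj hedgeless).mono (Nat.le_add_left 1 _)⟩
  | succ n ih =>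
    have hcolours : 3 * 2 ^ (n + 1) - 2 = 2 * (3 * 2 ^ n - 2 + 1) := by
      have := Nat.one_le_two_pow (n := n)
      rw [pow_succ]
      omega
    rw [hcolours]
    exact D.exists_clusteredOn_of_not_hasOddModelIn_coneCopies hb (U_connected _ _)
      (fun _ ↦ ih) fun h ↦ hS (h.of_isContained (U_isContained_coneCopies n (k + 1)))

end ClusteredColouring

end OddMinor

theorem lemma4 (d h w : ℕ) (hd : 1 ≤ d) (hh : 1 ≤ h) (hw : 1 ≤ w)
    {V : Type*} [Fintype V] (G : SimpleGraph V)
    (htw : OddMinor.treewidth G ≤ (w : ℤ))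
    (hG : ¬ ∃ M : OddMinor.Model (OddMinor.U h d) G, M.IsNontrivial ∧ M.IsOdd) :
    ∃ c : V → Fin (3 * 2 ^ (h - 1) - 2), OddMinor.HasClustering G c (d * w + d - w) := by
  obtain ⟨k, rfl⟩ := Nat.exists_eq_add_of_le' hd
  obtain ⟨n, rfl⟩ := Nat.exists_eq_add_of_le' hh
  obtain ⟨D, hD⟩ := OddMinor.exists_width_eq_treewidth G
  obtain ⟨c, hc⟩ := D.exists_clusteredOn_of_not_hasOddModelIn_U (D.card_bag_le (hD.trans_le htw))
    k n (S := Set.univ) fun hU ↦ hG hU.exists_model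
  have hm : (k + 1) * w + (k + 1) - w = k * (w + 1) + 1 := by
    rw [Nat.succ_mul, Nat.mul_succ]
    omega
  exact ⟨c, hm ▸ hc.hasClustering⟩
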